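/- For $n\in\mathbb{N}$ and $k\in\mathbb{N}$ let $\mathcal{G}_n(k)$ be the set of directed graphs $G=(N,E)$ without loops on $N=\{1,\dots,n\}$ in which every vertex has outdegree at most $k$; write $\delta^-(v,G)$ for the indegree of $v$ and $\Delta(G)=\max_{v}\delta^-(v,G)$. A (deterministic) selection mechanism $f$ maps each loopless directed graph $G$ on $N$ to a set $f(G)\subseteq N$ with $|f(G)|\le 1$. It is impartial on $\mathcal{G}_n(k)$ if $f(G)\cap\{v\}=f(G')\cap\{v\}$ for all $v\in N$ and all $G,G'\in\mathcal{G}_n(k)$ that differ at most in the outgoing edges of $v$, and it is $\alpha$-additive on $\mathcal{G}_n(k)$ if $\Delta(G)-\sum_{v\in f(G)}\delta^-(v,G)\le\alpha$ for all $G\in\mathcal{G}_n(k)$. The Twin Threshold Mechanism with integer thresholds $1\le t\le T$ works as follows. Start with $d=\Delta(G)$. While $d\ge t$: if there is a vertex whose outgoing edges have not yet been deleted and whose current indegree (not counting deleted edges) equals $d$, delete all outgoing edges of the vertex of greatest index among these; otherwise decrease $d$ by one. At the end, let $\hat\Delta$ be the maximum remaining indegree; if $\hat\Delta\ge T$, select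 the vertex of greatest index with remaining indegree $\hat\Delta$, and otherwise select no vertex. Theorem. (1) For every $c>0$ there is a constant $C>0$ such that for all $\kappa\in[0,1]$ and all $n,k\in\mathbb{N}$ with $k\le c\,n^{\kappa}$ there are integer thresholds $1\le t\le T$ for which the Twin Threshold Mechanism is impartial and $C\,n^{(1+\kappa)/2}$-additive on $\mathcal{G}_n(k)$. That is, for $k=O(n^\kappa)$ there is a deterministic impartial mechanism that is $O(n^{(1+\kappa)/2})$-additive on $\mathcal{G}_n(k)$. (2) For every $n\in\mathbb{N}$ there are integer thresholds $1\le t\le T$ for which the Twin Threshold Mechanism is impartial and $\sqrt{8n}$-additive on $\mathcal{G}_n(1)$. -/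

import Mathlib

/-- A directed graph without loops on the vertices `0 < 1 < ⋯ < n - 1`. -/
structure NominationGraph (n : ℕ) where
  /-- The set of edges; `(u, v)` is an edge from `u` to `v`. -/
  edges : Finset (Fin n × Fin n)
  /-- No vertex has an edge to itself. -/
  loopless : ∀ v : Fin n, (v, v) ∉ edges

namespace NominationGraph

variable {n : ℕ}

/-- The out-neighborhood of `v`. -/
def outNeighbors (G : NominationGraph n) (v : Fin n) : Finset (Fin n) :=
  Finset.univ.filter fun u => (v, u) ∈ G.edges

/-- The in-neighborhood of `v`. -/
def inNeighbors (G : NominationGraph n) (v : Fin n) : Finset (Fin n) :=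
  Finset.univ.filter fun u => (u, v) ∈ G.edges

/-- The outdegree of `v`. -/
def outdegree (G : NominationGraph n) (v : Fin n) : ℕ := (G.outNeighbors v).card

/-- The indegree of `v`. -/
def indegree (G : NominationGraph n) (v : Fin n) : ℕ := (G.inNeighbors v).card

/-- The maximum indegree (it is `0` for the graph without vertices). -/
def maxIndegree (G : NominationGraph n) : ℕ := Finset.univ.sup G.indegree

/-- The edges that do not start in `v`. -/
def edgesNotFrom (G : NominationGraph n) (v : Fin n) : Finset (Fin n × Fin n) :=
  G.edges.filter fun e => e.1 ≠ v

/-- The graphs on `n` vertices in which every outdegree is at most `k`. -/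
def withOutdegreeLE (n k : ℕ) : Set (NominationGraph n) :=
  {G | ∀ v, G.outdegree v ≤ k}

end NominationGraph

/-- A deterministic selection mechanism for `n` vertices: it selects at most one vertex of each
graph. -/
structure SelectionMechanism (n : ℕ) where
  /-- The set of selected vertices. -/
  select : NominationGraph n → Finset (Fin n)
  /-- At most one vertex is selected. -/
  card_select_le_one : ∀ G, (select G).card ≤ 1

namespace SelectionMechanism

variable {n : ℕ}

/-- Impartiality on a set of graphs: the outgoing edges of a vertex have no influence on whether
that vertex is selected. -/
def ImpartialOn (f : SelectionMechanism n) (𝒢 : Set (NominationGraph n)) : Prop :=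
  ∀ G ∈ 𝒢, ∀ G' ∈ 𝒢, ∀ v : Fin n,
    G.edgesNotFrom v = G'.edgesNotFrom v → f.select G ∩ {v} = f.select G' ∩ {v}

/-- `α`-additivity on a set of graphs: the indegree of the choice (`0` if no vertex is selected)
falls short of the maximum indegree by at most `α`. -/
def AdditiveOn (f : SelectionMechanism n) (α : ℝ) (𝒢 : Set (NominationGraph n)) : Prop :=
  ∀ G ∈ 𝒢, (G.maxIndegree : ℝ) - ((∑ v ∈ f.select G, G.indegree v : ℕ) : ℝ) ≤ α

end SelectionMechanism

namespace TwinThreshold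

variable {n : ℕ}

/-- The variables of the deletion loop. -/
structure State (n : ℕ) where
  /-- The indegree that is currently considered. -/
  level : ℕ
  /-- The vertices whose outgoing edges have been deleted. -/
  deleted : Finset (Fin n)
  /-- The indegrees, omitting deleted edges. -/
  deg : Fin n → ℕ

/-- The initial state. -/
def init (G : NominationGraph n) : State n where
  level := G.maxIndegree
  deleted := ∅
  deg := G.indegree

/-- The vertices with current indegree equal to the current level whose outgoing edges have not
been deleted. -/
def candidates (s : State n) : Finset (Fin n) :=
  Finset.univ.filter fun u => u ∉ s.deleted ∧ s.deg u = s.level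

/-- Delete the outgoing edges of `v`. -/
def delete (G : NominationGraph n) (s : State n) (v : Fin n) : State n where
  level := s.level
  deleted := insert v s.deleted
  deg := fun u => if u ∈ G.outNeighbors v then s.deg u - 1 else s.deg u

/-- Lower the current level by one. -/
def lower (s : State n) : State n := { s with level := s.level - 1 }

theorem delete_measure_lt (G : NominationGraph n) (s : State n) (v : Fin n)
    (hv : v ∈ candidates s) :
    (delete G s v).level + (Finset.univ \ (delete G s v).deleted).card <
      s.level + (Finset.univ \ s.deleted).card := by
  have hv' : v ∉ s.deleted := (Finset.mem_filter.mp hv).2.1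
  have h : (Finset.univ \ insert v s.deleted) ⊂ (Finset.univ \ s.deleted) := by
    rw [Finset.ssubset_iff_of_subset
      (Finset.sdiff_subset_sdiff le_rfl (Finset.subset_insert v s.deleted))]
    exact ⟨v, by simp [hv'], by simp⟩
  have := Finset.card_lt_card h
  simp only [delete]
  omega

/-- The deletion loop with lower threshold `t`: as long as the level is at least `t`, delete the
outgoing edges of the greatest candidate, or lower the level if there is no candidate.
(The condition `0 < s.level` only matters for `t = 0`.) -/
def loop (G : NominationGraph n) (t : ℕ) (s : State n) : State n :=
  if _hs : t ≤ s.level ∧ 0 < s.level then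
    if h : (candidates s).Nonempty then
      loop G t (delete G s ((candidates s).max' h))
    else
      loop G t (lower s)
  else s
termination_by s.level + (Finset.univ \ s.deleted).card
decreasing_by
  · exact delete_measure_lt G s _ (Finset.max'_mem _ h)
  · simp only [lower]
    omega

/-- The indegrees that remain when the deletion loop ends. -/
def finalDegree (G : NominationGraph n) (t : ℕ) : Fin n → ℕ := (loop G t (init G)).deg

/-- The maximum remaining indegree. -/
def maxFinalDegree (G : NominationGraph n) (t : ℕ) : ℕ := Finset.univ.sup (finalDegree G t)

/-- If the maximum remaining indegree is at least `T`, the greatest vertex that attains it. -/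
def selected (T t : ℕ) (G : NominationGraph n) : Finset (Fin n) :=
  if T ≤ maxFinalDegree G t then
    Finset.univ.filter fun v => finalDegree G t v = maxFinalDegree G t ∧
      ∀ u, finalDegree G t u = maxFinalDegree G t → u ≤ v
  else ∅

theorem card_selected_le_one (T t : ℕ) (G : NominationGraph n) :
    (selected T t G).card ≤ 1 := by
  unfold selected
  split_ifs
  · rw [Finset.card_le_one]
    intro a ha b hb
    rw [Finset.mem_filter] at ha hb
    exact le_antisymm (hb.2.2 a ha.2.1) (ha.2.2 b hb.2.1)
  · simp

end TwinThreshold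

/-- The Twin Threshold Mechanism with upper threshold `T` and lower threshold `t`. -/
def twinThresholdMechanism (n T t : ℕ) : SelectionMechanism n where
  select := TwinThreshold.selected T t
  card_select_le_one := TwinThreshold.card_selected_le_one T t

/-! ### Degree counting -/

namespace NominationGraph

variable {n : ℕ}

/-! A run of the loop is encoded by the levels `x` at which vertices are deleted. `IsDeletionLevels`
keeps what matters: a vertex is deleted at level `d` only if at least `d` in-neighbors are then
left, and passed over only if fewer are. `exists_isDeletionLevels` extracts `x` from the loop.

Impartiality: let `G` and `H` differ only in out-edges of `v`, with `v` selected in `G`, so `T ≤ x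
v`. Once the same vertices, `v` among them, are deleted in both, the runs agree from there on. A
difference that persists down to `t` needs at least `T - t` deletions (`le_card_deletedFrom`).
Deleted vertices have indegree at least `t`, so this takes `t * (T - t)` edges, more than the `n *
k` available. Hence the runs end alike and select the same vertex.

Additivity: if a vertex of maximum indegree `D` keeps `f`, its `D - f` lost in-neighbors have
indegree at least `t` each, so `D + t * (D - f) ≤ n * k` (`indegree_add_mul_le`). A selected vertex
has indegree at least `f`; if none is selected, `f < T`. Taking `T` about `t + n * k / t` and `t` of
order `√(n * k)` balances the losses. -/

theorem mem_inNeighbors (G : NominationGraph n) (u w : Fin n) :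
    w ∈ G.inNeighbors u ↔ (w, u) ∈ G.edges := by
  simp [inNeighbors]

theorem mem_outNeighbors (G : NominationGraph n) (u w : Fin n) :
    w ∈ G.outNeighbors u ↔ (u, w) ∈ G.edges := by
  simp [outNeighbors]

theorem mem_inNeighbors_congr {G H : NominationGraph n} {v : Fin n}
    (hGH : G.edgesNotFrom v = H.edgesNotFrom v) {w : Fin n} (hw : w ≠ v) (u : Fin n) :
    w ∈ G.inNeighbors u ↔ w ∈ H.inNeighbors u := by
  have h := congrArg (fun s => (w, u) ∈ s) hGH
  simpa [edgesNotFrom, mem_inNeighbors, hw] using h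

theorem sum_indegree_eq_sum_outdegree (G : NominationGraph n) :
    ∑ u, G.indegree u = ∑ u, G.outdegree u := by
  simp only [indegree, outdegree, inNeighbors, outNeighbors, Finset.card_filter]
  exact Finset.sum_comm

theorem sum_indegree_le {G : NominationGraph n} {k : ℕ} (hG : G ∈ withOutdegreeLE n k) :
    ∑ u, G.indegree u ≤ n * k := by
  rw [sum_indegree_eq_sum_outdegree]
  calc ∑ u, G.outdegree u ≤ ∑ _u : Fin n, k := Finset.sum_le_sum fun u _ => hG u
    _ = n * k := by simp

end NominationGraph

/-! ### The deletion loop as a table of deletion levels -/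

namespace TwinThreshold

open NominationGraph

variable {n : ℕ}

/-- With `x w` the level at which `w` is deleted (`0` if it is not), `w` is deleted before the loop
considers `u` at level `d`. -/
def DeletedBefore (x : Fin n → ℕ) (d : ℕ) (u w : Fin n) : Prop :=
  d < x w ∨ (x w = d ∧ u < w)

instance (x : Fin n → ℕ) (d : ℕ) (u : Fin n) : DecidablePred (DeletedBefore x d u) :=
  fun _ => inferInstanceAs (Decidable (_ ∨ _))

/-- The in-neighbors of `u` that are not deleted when the loop considers `u` at level `d`. -/
def remaining (G : NominationGraph n) (x : Fin n → ℕ) (d : ℕ) (u : Fin n) : Finset (Fin n) :=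
  (G.inNeighbors u).filter fun w => ¬ DeletedBefore x d u w

/-- The in-neighbors of `u` that are never deleted. -/
def survivors (G : NominationGraph n) (x : Fin n → ℕ) (u : Fin n) : Finset (Fin n) :=
  (G.inNeighbors u).filter fun w => x w = 0

/-- The vertices deleted at level `d` or above. -/
def deletedFrom (x : Fin n → ℕ) (d : ℕ) : Finset (Fin n) :=
  Finset.univ.filter fun w => d ≤ x w

theorem mem_deletedFrom {x : Fin n → ℕ} {d : ℕ} {w : Fin n} :
    w ∈ deletedFrom x d ↔ d ≤ x w := by
  simp [deletedFrom]

/-- The characteristic properties of the levels at which the loop with lower threshold `t` deletes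
the vertices. -/
structure IsDeletionLevels (G : NominationGraph n) (t : ℕ) (x : Fin n → ℕ) : Prop where
  threshold_le : ∀ u, x u ≠ 0 → t ≤ x u
  le_card : ∀ u, x u ≤ (remaining G x (x u) u).card
  card_lt : ∀ u d, t ≤ d → x u < d → (remaining G x d u).card < d

/-- The loop invariant: `x` records the levels of the deletions so far. -/
structure LoopInvariant (G : NominationGraph n) (t : ℕ) (s : State n) (x : Fin n → ℕ) : Prop where
  mem_deleted : ∀ u, u ∈ s.deleted ↔ x u ≠ 0
  deg_eq : ∀ u, s.deg u = (survivors G x u).card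
  threshold_le : ∀ u, x u ≠ 0 → t ≤ x u
  level_le : ∀ u, x u ≠ 0 → s.level ≤ x u
  deg_le : ∀ u, x u = 0 → s.deg u ≤ s.level
  candidate_lt : ∀ u w, x u ≠ 0 → x u = s.level → x w = 0 → s.deg w = s.level → w < u
  le_card : ∀ u, x u ≤ (remaining G x (x u) u).card
  card_lt : ∀ u d, s.level < d → x u < d → (remaining G x d u).card < d
  card_lt_or : ∀ u, x u = 0 → s.deg u = s.level ∨ (remaining G x s.level u).card < s.level

theorem loopInvariant_init (G : NominationGraph n) (t : ℕ) :
    LoopInvariant G t (init G) (fun _ => 0) := by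
  have hle : ∀ u, G.indegree u ≤ G.maxIndegree := fun u =>
    Finset.le_sup (f := G.indegree) (Finset.mem_univ u)
  have hrem : ∀ d u, (remaining G (fun _ => 0) d u).card ≤ G.indegree u := fun d u =>
    Finset.card_filter_le _ _
  refine ⟨by simp [init], fun u => by simp [init, survivors, indegree], by simp, by simp,
    fun u _ => hle u, by simp, by simp, fun u d hd _ => ?_, fun u _ => ?_⟩
  · exact ((hrem d u).trans (hle u)).trans_lt hd
  · rcases (hle u).eq_or_lt with h | h
    · exact Or.inl h
    · exact Or.inr ((hrem _ u).trans_lt h)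

/-- Without candidates, every undeleted vertex has degree below the level, which settles `card_lt`
for the level being left. -/
theorem LoopInvariant.lower {G : NominationGraph n} {t : ℕ} {s : State n} {x : Fin n → ℕ}
    (hx : LoopInvariant G t s x) (hpos : 0 < s.level) (hs : ¬ (candidates s).Nonempty) :
    LoopInvariant G t (lower s) x := by
  have hne : ∀ u, x u = 0 → s.deg u ≠ s.level := by
    intro u hu h
    exact hs ⟨u, by simp [candidates, hx.mem_deleted, hu, h]⟩
  have hlt : ∀ u, x u = 0 → s.deg u < s.level := fun u hu =>
    lt_of_le_of_ne (hx.deg_le u hu) (hne u hu)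
  have hlevel : ∀ u, x u ≠ 0 → s.level ≤ x u := hx.level_le
  refine ⟨hx.mem_deleted, hx.deg_eq, hx.threshold_le, ?_, ?_, ?_, hx.le_card, ?_, ?_⟩
  · intro u hu
    have := hlevel u hu
    simp only [TwinThreshold.lower]
    omega
  · intro u hu
    have := hlt u hu
    simp only [TwinThreshold.lower]
    omega
  · intro u w hu hul
    have := hlevel u hu
    simp only [TwinThreshold.lower] at hul
    omega
  · intro u d hd hud
    simp only [TwinThreshold.lower] at hd
    rcases (show s.level ≤ d by omega).eq_or_lt with h | h
    · subst h
      have hu : x u = 0 := by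
        by_contra h0
        have := hlevel u h0
        omega
      exact (hx.card_lt_or u hu).resolve_left (hne u hu)
    · exact hx.card_lt u d h hud
  · intro u hu
    have h2 := hlt u hu
    -- At the new level 0 the strict bound is impossible, but degrees below 1 equal the level.
    rcases (show 1 ≤ s.level from hpos).eq_or_lt with hone | hone
    · left
      simp only [TwinThreshold.lower]
      omega
    have h1 : remaining G x (s.level - 1) u = survivors G x u := by
      refine Finset.filter_congr fun w _ => ?_
      unfold DeletedBefore
      by_cases hw : x w = 0
      · omega
      · have := hlevel w hw
        omega
    have h3 := hx.deg_eq u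
    simp only [TwinThreshold.lower, h1]
    omega

/-- Degrees only fall, so no new candidates arise at a level, and its deletions occur in decreasing
order of index. This is why `DeletedBefore` can be read off from levels and indices alone. -/
theorem LoopInvariant.delete {G : NominationGraph n} {t : ℕ} {s : State n} {x : Fin n → ℕ}
    (hx : LoopInvariant G t s x) (ht : t ≤ s.level) (hpos : 0 < s.level) {v : Fin n}
    (hv : v ∈ candidates s) (hmax : ∀ u ∈ candidates s, u ≤ v) :
    LoopInvariant G t (delete G s v) (Function.update x v s.level) := by
  have hv' : v ∉ s.deleted ∧ s.deg v = s.level := by simpa [candidates] using hv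
  have hxv : x v = 0 := by simpa [hx.mem_deleted] using hv'.1
  have hcand : ∀ u, x u = 0 → s.deg u = s.level → u ≤ v := by
    intro u hu h
    exact hmax u (by simp [candidates, hx.mem_deleted, hu, h])
  have hdeg : ∀ u, (TwinThreshold.delete G s v).deg u =
      (survivors G (Function.update x v s.level) u).card := by
    intro u
    have hset : survivors G (Function.update x v s.level) u = (survivors G x u).erase v := by
      ext w
      by_cases hw : w = v
      · subst hw
        simp [survivors, hpos.ne']
      · simp [survivors, hw]
    rw [hset]
    simp only [TwinThreshold.delete, hx.deg_eq]
    split_ifs with h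
    · rw [Finset.card_erase_of_mem]
      simp [survivors, hxv, mem_inNeighbors, (mem_outNeighbors _ _ _).1 h]
    · rw [Finset.erase_eq_of_notMem]
      rw [mem_outNeighbors] at h
      simp [survivors, mem_inNeighbors, h]
  have hdeg_le : ∀ u, (TwinThreshold.delete G s v).deg u ≤ s.deg u := by
    intro u
    simp only [TwinThreshold.delete]
    split_ifs <;> omega
  have hzero : ∀ u, Function.update x v s.level u = 0 → u ≠ v ∧ x u = 0 := by
    intro u hu
    by_cases h : u = v
    · subst h
      simp at hu
      omega
    · simpa [h] using hu
  have hbefore : ∀ d u w, DeletedBefore x d u w →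
      DeletedBefore (Function.update x v s.level) d u w := by
    intro d u w h
    by_cases hw : w = v
    · subst hw
      refine Or.inl ?_
      rw [Function.update_self]
      rcases h with h | ⟨h, -⟩ <;> omega
    · simpa [DeletedBefore, hw] using h
  have hrem : ∀ d u, (remaining G (Function.update x v s.level) d u).card ≤
      (remaining G x d u).card := fun d u =>
    Finset.card_le_card (Finset.monotone_filter_right _ fun w _ h hw => h (hbefore d u w hw))
  refine ⟨?_, hdeg, ?_, ?_, ?_, ?_, ?_, ?_, ?_⟩
  · intro u
    by_cases h : u = v
    · subst h
      simp [TwinThreshold.delete, hpos.ne']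
    · simp [TwinThreshold.delete, h, hx.mem_deleted]
  · intro u hu
    by_cases h : u = v
    · subst h
      simpa using ht
    · simp only [Function.update_of_ne h] at hu ⊢
      exact hx.threshold_le u hu
  · intro u hu
    by_cases h : u = v
    · subst h
      simp [TwinThreshold.delete]
    · simp only [Function.update_of_ne h] at hu ⊢
      exact hx.level_le u hu
  · intro u hu
    exact (hdeg_le u).trans (hx.deg_le u (hzero u hu).2)
  · intro u w hu hul hw hwl
    obtain ⟨hwv, hw0⟩ := hzero w hw
    have hwl' : s.deg w = s.level := le_antisymm (hx.deg_le w hw0) (hwl ▸ hdeg_le w)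
    by_cases h : u = v
    · subst h
      exact lt_of_le_of_ne (hcand w hw0 hwl') hwv
    · simp only [Function.update_of_ne h] at hu hul
      exact hx.candidate_lt u w hu hul hw0 hwl'
  · intro u
    by_cases h : u = v
    · subst h
      rw [Function.update_self]
      calc s.level = s.deg u := hv'.2.symm
        _ = (survivors G x u).card := hx.deg_eq u
        _ ≤ _ := Finset.card_le_card (Finset.monotone_filter_right _ fun w _ hw => ?_)
      by_cases hwu : w = u
      · subst hwu
        simp [DeletedBefore]
      · simp only [DeletedBefore, Function.update_of_ne hwu]
        omega
    · rw [Function.update_of_ne h]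
      rcases Nat.eq_zero_or_pos (x u) with h0 | h0
      · omega
      refine (hx.le_card u).trans
        (Finset.card_le_card (Finset.monotone_filter_right _ fun w _ hw => ?_))
      -- The new deletion does not precede an earlier one: its level is no higher, and at equal
      -- level its index is smaller.
      by_cases hwv : w = v
      · subst hwv
        have h1 := hx.level_le u h0.ne'
        have h2 := hx.candidate_lt u w h0.ne'
        simp only [DeletedBefore, Function.update_self]
        rintro (h3 | ⟨h3, h4⟩)
        · omega
        · exact lt_asymm h4 (h2 h3.symm hxv hv'.2)
      · simpa only [DeletedBefore, Function.update_of_ne hwv] using hw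
  · intro u d hd hud
    refine (hrem d u).trans_lt (hx.card_lt u d hd ?_)
    by_cases h : u = v
    · subst h
      omega
    · simpa [h] using hud
  · intro u hu
    obtain ⟨huv, hu0⟩ := hzero u hu
    rcases hx.card_lt_or u hu0 with h | h
    · rcases ((hdeg_le u).trans_eq h).eq_or_lt with h' | h'
      · exact Or.inl h'
      -- Here `u` drops below the level before its turn. It was a candidate until now, so all
      -- deletions so far precede it.
      · right
        refine lt_of_le_of_lt ?_ h'
        rw [hdeg]
        refine Finset.card_le_card (Finset.monotone_filter_right _ fun w _ hw => ?_)
        by_contra hw0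
        refine hw ?_
        by_cases hwv : w = v
        · subst hwv
          exact Or.inr ⟨Function.update_self .., lt_of_le_of_ne (hcand u hu0 h) huv⟩
        · simp only [Function.update_of_ne hwv] at hw0
          simp only [DeletedBefore, Function.update_of_ne hwv]
          rcases (hx.level_le w hw0).eq_or_lt with h1 | h1
          · exact Or.inr ⟨h1.symm, hx.candidate_lt w u hw0 h1.symm hu0 h⟩
          · exact Or.inl h1
    · exact Or.inr ((hrem _ u).trans_lt h)

theorem exists_loopInvariant_loop (G : NominationGraph n) (t : ℕ) (s : State n) (x : Fin n → ℕ)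
    (hx : LoopInvariant G t s x) :
    ∃ y, LoopInvariant G t (loop G t s) y ∧ ¬ (t ≤ (loop G t s).level ∧ 0 < (loop G t s).level) := by
  induction s using loop.induct (G := G) (t := t) generalizing x with
  | case1 s hs h ih =>
    rw [loop, dif_pos hs, dif_pos h]
    exact ih _ (hx.delete hs.1 hs.2 (Finset.max'_mem _ h) fun u hu => Finset.le_max' _ u hu)
  | case2 s hs h ih =>
    rw [loop, dif_pos hs, dif_neg h]
    exact ih _ (hx.lower hs.2 h)
  | case3 s hs =>
    rw [loop, dif_neg hs]
    exact ⟨x, hx, hs⟩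

theorem exists_isDeletionLevels (G : NominationGraph n) {t : ℕ} (ht : 1 ≤ t) :
    ∃ x, IsDeletionLevels G t x ∧ ∀ u, finalDegree G t u = (survivors G x u).card := by
  obtain ⟨x, hx, hs⟩ := exists_loopInvariant_loop G t (init G) _ (loopInvariant_init G t)
  exact ⟨x, ⟨hx.threshold_le, hx.le_card, fun u d hd h => hx.card_lt u d (by omega) h⟩, hx.deg_eq⟩

/-! ### Comparing graphs that differ in the out-edges of one vertex -/

namespace IsDeletionLevels

variable {G H : NominationGraph n} {t : ℕ} {x y : Fin n → ℕ} {v : Fin n}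

theorem le_indegree (hx : IsDeletionLevels G t x) (u : Fin n) : x u ≤ G.indegree u :=
  (hx.le_card u).trans (Finset.card_filter_le _ _)

theorem mul_card_deletedFrom_le (hx : IsDeletionLevels G t x) {k : ℕ}
    (hG : G ∈ withOutdegreeLE n k) : t * (deletedFrom x t).card ≤ n * k := by
  calc t * (deletedFrom x t).card = ∑ _u ∈ deletedFrom x t, t := by
        rw [Finset.sum_const, smul_eq_mul, mul_comm]
    _ ≤ ∑ u ∈ deletedFrom x t, G.indegree u :=
        Finset.sum_le_sum fun u hu => (mem_deletedFrom.1 hu).trans (hx.le_indegree u)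
    _ ≤ ∑ u, G.indegree u :=
        Finset.sum_le_sum_of_subset (Finset.subset_univ _)
    _ ≤ n * k := sum_indegree_le hG

/-- If the same vertices, among them `v`, are deleted at level `d + 1` or above, then no vertex is
the greatest one to be deleted at level `d` in `G` but not in `H`. -/
theorem false_of_greatest_difference (hx : IsDeletionLevels G t x) (hy : IsDeletionLevels H t y)
    (hGH : G.edgesNotFrom v = H.edgesNotFrom v) {d : ℕ} (hd : t ≤ d)
    (h : deletedFrom x (d + 1) = deletedFrom y (d + 1)) (hv : v ∈ deletedFrom x (d + 1))
    {u : Fin n} (hux : d ≤ x u) (huy : y u < d)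
    (hmax : ∀ w, u < w → (d ≤ x w ↔ d ≤ y w)) : False := by
  have hiff : ∀ w, d + 1 ≤ x w ↔ d + 1 ≤ y w := fun w => by
    rw [← mem_deletedFrom, h, mem_deletedFrom]
  have hxu : x u = d := by
    have := hiff u
    omega
  have h1 := hx.le_card u
  have h2 := hy.card_lt u d hd huy
  rw [hxu] at h1
  refine absurd (h1.trans (Finset.card_le_card fun w hw => ?_)) (not_le.2 h2)
  obtain ⟨hwG, hw⟩ := Finset.mem_filter.1 hw
  have hwv : w ≠ v := by
    rintro rfl
    exact hw (Or.inl (mem_deletedFrom.1 hv))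
  refine Finset.mem_filter.2 ⟨(mem_inNeighbors_congr hGH hwv u).1 hwG, fun hw' => hw ?_⟩
  have h3 := hiff w
  rcases hw' with h4 | ⟨h4, h5⟩
  · exact Or.inl (h3.2 h4)
  · have h6 := hmax w h5
    exact Or.inr ⟨by omega, h5⟩

/-- If the same vertices, among them `v`, are deleted at level `d + 1` or above, then also at
level `d` or above. -/
theorem deletedFrom_eq_of_succ (hx : IsDeletionLevels G t x) (hy : IsDeletionLevels H t y)
    (hGH : G.edgesNotFrom v = H.edgesNotFrom v) {d : ℕ} (hd : t ≤ d)
    (h : deletedFrom x (d + 1) = deletedFrom y (d + 1)) (hv : v ∈ deletedFrom x (d + 1)) :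
    deletedFrom x d = deletedFrom y d := by
  by_contra hne
  have hS : (Finset.univ.filter fun u => ¬ (d ≤ x u ↔ d ≤ y u)).Nonempty := by
    by_contra h0
    rw [Finset.not_nonempty_iff_eq_empty, Finset.filter_eq_empty_iff] at h0
    refine hne (Finset.ext fun w => ?_)
    rw [mem_deletedFrom, mem_deletedFrom]
    exact not_not.1 (h0 (Finset.mem_univ w))
  obtain ⟨u, hu, hmax⟩ := Finset.exists_max_image _ id hS
  have hmax' : ∀ w, u < w → (d ≤ x w ↔ d ≤ y w) := by
    intro w hw
    by_contra hw'
    exact absurd (hmax w (by simpa using hw')) (not_le.2 hw)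
  have hu' := (Finset.mem_filter.1 hu).2
  by_cases hux : d ≤ x u
  · exact hx.false_of_greatest_difference hy hGH hd h hv hux (by omega) hmax'
  · exact hy.false_of_greatest_difference hx hGH.symm hd h.symm (h ▸ hv) (u := u)
      (by tauto) (by omega) fun w hw => (hmax' w hw).symm

theorem deletedFrom_eq_of_le (hx : IsDeletionLevels G t x) (hy : IsDeletionLevels H t y)
    (hGH : G.edgesNotFrom v = H.edgesNotFrom v) {d e : ℕ} (hd : t ≤ d) (hde : d ≤ e)
    (h : deletedFrom x e = deletedFrom y e) (hv : e ≤ x v) :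
    deletedFrom x d = deletedFrom y d := by
  induction e, hde using Nat.le_induction with
  | base => exact h
  | succ e hde ih =>
    exact ih (hx.deletedFrom_eq_of_succ hy hGH (hd.trans hde) h (mem_deletedFrom.2 hv)) (by omega)

/-- If some vertex is deleted at level `d` or above in `G` but not in `H`, then the first one in `G`
lost many in-neighbors in `H`. -/
theorem exists_card_deletedFrom_le (hx : IsDeletionLevels G t x) (hy : IsDeletionLevels H t y)
    (hGH : G.edgesNotFrom v = H.edgesNotFrom v) {d : ℕ} (hd : t ≤ d)
    (h : (deletedFrom x d \ deletedFrom y d).Nonempty) :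
    ∃ l, d ≤ l ∧ ((deletedFrom x (l + 1)).card + (l + 1) ≤ (deletedFrom y d).card + d ∨
      (x v ≤ l ∧ y v < d ∧ l ≤ (deletedFrom y d).card + d)) := by
  -- The lexicographic maximum is the first deletion: higher levels come first, then greater
  -- indices.
  obtain ⟨u, hu, hmax⟩ := Finset.exists_max_image _ (fun u => toLex (x u, u)) h
  simp only [Finset.mem_sdiff, mem_deletedFrom, not_le] at hu hmax
  refine ⟨x u, hu.1, ?_⟩
  set A := Finset.univ.filter fun w => DeletedBefore x (x u) u w with hA
  have hsub : A ⊆ deletedFrom y d := by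
    intro w hw
    rw [mem_deletedFrom]
    by_contra hwd
    have hw' : DeletedBefore x (x u) u w := (Finset.mem_filter.1 hw).2
    have hle := hmax w ⟨by unfold DeletedBefore at hw'; omega, by omega⟩
    rw [Prod.Lex.toLex_le_toLex] at hle
    rcases hw' with h1 | ⟨h1, h2⟩
    · rcases hle with h3 | ⟨h3, h4⟩ <;> simp only at h3 <;> omega
    · rcases hle with h3 | ⟨h3, h4⟩
      · simp only at h3
        omega
      · exact absurd h2 (not_lt.2 h4)
  have hsucc : (deletedFrom x (x u + 1)).card ≤ A.card := Finset.card_le_card fun w hw =>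
    Finset.mem_filter.2 ⟨Finset.mem_univ w, Or.inl (mem_deletedFrom.1 hw)⟩
  have hcard : (deletedFrom y d \ A).card + A.card = (deletedFrom y d).card :=
    Finset.card_sdiff_add_card_eq_card hsub
  have h1 := hx.le_card u
  have h2 := hy.card_lt u d hd hu.2
  -- In-neighbors of `u` remaining in `G` but not in `H` lie in `deletedFrom y d \ A`, except
  -- possibly `v`, whose out-edges may differ. That exception costs the extra one in the second
  -- alternative.
  by_cases hv : v ∈ A ∨ v ∈ deletedFrom y d
  · left
    have h3 : remaining G x (x u) u ⊆ remaining H y d u ∪ (deletedFrom y d \ A) := by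
      intro w hw
      obtain ⟨hwG, hw⟩ := Finset.mem_filter.1 hw
      have hwA : w ∉ A := by simpa [hA] using hw
      by_cases hwy : w ∈ deletedFrom y d
      · exact Finset.mem_union_right _ (Finset.mem_sdiff.2 ⟨hwy, hwA⟩)
      · have hwv : w ≠ v := by
          rintro rfl
          tauto
        rw [mem_deletedFrom] at hwy
        refine Finset.mem_union_left _ (Finset.mem_filter.2
          ⟨(mem_inNeighbors_congr hGH hwv u).1 hwG, ?_⟩)
        unfold DeletedBefore
        omega
    have h4 := (Finset.card_le_card h3).trans (Finset.card_union_le _ _)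
    omega
  · right
    rw [not_or, mem_deletedFrom] at hv
    have hvA : ¬ DeletedBefore x (x u) u v := by simpa [hA] using hv.1
    refine ⟨by unfold DeletedBefore at hvA; omega, by omega, ?_⟩
    have h3 : remaining G x (x u) u ⊆ insert v (remaining H y d u ∪ (deletedFrom y d \ A)) := by
      intro w hw
      obtain ⟨hwG, hw⟩ := Finset.mem_filter.1 hw
      have hwA : w ∉ A := by simpa [hA] using hw
      by_cases hwv : w = v
      · exact hwv ▸ Finset.mem_insert_self _ _
      refine Finset.mem_insert_of_mem ?_
      by_cases hwy : w ∈ deletedFrom y d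
      · exact Finset.mem_union_right _ (Finset.mem_sdiff.2 ⟨hwy, hwA⟩)
      · rw [mem_deletedFrom] at hwy
        refine Finset.mem_union_left _ (Finset.mem_filter.2
          ⟨(mem_inNeighbors_congr hGH hwv u).1 hwG, ?_⟩)
        unfold DeletedBefore
        omega
    have h4 := (Finset.card_le_card h3).trans (Finset.card_insert_le _ _)
    have h5 := Finset.card_union_le (remaining H y d u) (deletedFrom y d \ A)
    omega

/-- As long as the deleted vertices differ for two graphs that agree outside the outgoing edges of
`v`, there has been a deletion for every level since the deletion of `v`. -/
theorem le_card_deletedFrom (hx : IsDeletionLevels G t x) (hy : IsDeletionLevels H t y)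
    (hGH : G.edgesNotFrom v = H.edgesNotFrom v) {T : ℕ} (hv : T ≤ x v) {d : ℕ} (hd : t ≤ d)
    (hdT : d ≤ T) (hne : deletedFrom x d ≠ deletedFrom y d) :
    T ≤ (deletedFrom x d).card + d ∧ T ≤ (deletedFrom y d).card + d := by
  induction hm : T - d using Nat.strong_induction_on generalizing d with
  | _ m ih =>
    have hstep : ∀ l, d ≤ l → l < T →
        T ≤ (deletedFrom x (l + 1)).card + (l + 1) ∧
          T ≤ (deletedFrom y (l + 1)).card + (l + 1) := by
      intro l hl hlT
      -- Agreement at level `l + 1 ≤ T ≤ x v` would propagate down to `d`.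
      exact ih (T - (l + 1)) (by omega) (by omega) hlT (fun heq => hne
        (hx.deletedFrom_eq_of_le hy hGH hd (by omega) heq (by omega))) rfl
    have hA : (deletedFrom x d \ deletedFrom y d).Nonempty → T ≤ (deletedFrom y d).card + d := by
      intro h
      obtain ⟨l, hl, h | h⟩ := hx.exists_card_deletedFrom_le hy hGH hd h
      · by_cases hlT : l < T
        · have := hstep l hl hlT
          omega
        · omega
      · omega
    have hB : (deletedFrom y d \ deletedFrom x d).Nonempty → T ≤ (deletedFrom x d).card + d := by
      intro h
      obtain ⟨l, hl, h | h⟩ := hy.exists_card_deletedFrom_le hx hGH.symm hd h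
      · by_cases hlT : l < T
        · have := hstep l hl hlT
          omega
        · omega
      -- With the roles swapped, the second alternative would give `x v < d ≤ T`.
      · omega
    rcases (deletedFrom x d \ deletedFrom y d).eq_empty_or_nonempty with h1 | h1
    · rw [Finset.sdiff_eq_empty_iff_subset] at h1
      have h2 : (deletedFrom y d \ deletedFrom x d).Nonempty := by
        rw [Finset.sdiff_nonempty]
        exact fun h => hne (h1.antisymm h)
      have h3 := Finset.card_le_card h1
      have h4 := hB h2
      omega
    · have h2 := hA h1
      rcases (deletedFrom y d \ deletedFrom x d).eq_empty_or_nonempty with h3 | h3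
      · rw [Finset.sdiff_eq_empty_iff_subset] at h3
        have h4 := Finset.card_le_card h3
        omega
      · exact ⟨hB h3, h2⟩

/-- A vertex with large remaining indegree is deleted at a high level. -/
theorem le_of_le_card_survivors (hx : IsDeletionLevels G t x) {T : ℕ} (ht : t ≤ T)
    (hv : T ≤ (survivors G x v).card) : T ≤ x v := by
  by_contra h
  refine absurd (hv.trans (Finset.card_le_card ?_)) (not_le.2 (hx.card_lt v T ht (not_le.1 h)))
  refine Finset.monotone_filter_right _ fun w _ hw => ?_
  unfold DeletedBefore
  omega

theorem survivors_eq (hx : IsDeletionLevels G t x) (hy : IsDeletionLevels H t y)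
    (hGH : G.edgesNotFrom v = H.edgesNotFrom v) (ht : 1 ≤ t)
    (h : deletedFrom x t = deletedFrom y t) (hv : t ≤ x v) (u : Fin n) :
    survivors G x u = survivors H y u := by
  have hiff : ∀ w, t ≤ x w ↔ t ≤ y w := fun w => by
    rw [← mem_deletedFrom, h, mem_deletedFrom]
  ext w
  have h1 := hiff w
  have h2 := hx.threshold_le w
  have h3 := hy.threshold_le w
  have h4 : x w = 0 ↔ y w = 0 := by omega
  by_cases hw : w = v
  · subst hw
    have h5 : x w ≠ 0 := by omega
    have h6 : y w ≠ 0 := by omega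
    simp [survivors, h5, h6]
  · simp [survivors, mem_inNeighbors_congr hGH hw, h4]

/-! ### Indegree lost to deletions, and the two guarantees -/

/-- The deletions that lower the indegree of `u` use up edges that do not end in `u`. -/
theorem indegree_add_mul_le (hx : IsDeletionLevels G t x) {k : ℕ}
    (hG : G ∈ withOutdegreeLE n k) (u : Fin n) :
    G.indegree u + t * (G.indegree u - (survivors G x u).card) ≤ n * k := by
  set M := (G.inNeighbors u).filter fun w => ¬ x w = 0 with hM
  have hcard : (survivors G x u).card + M.card = G.indegree u :=
    Finset.card_filter_add_card_filter_not _
  have hu : u ∉ M := by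
    simp [hM, mem_inNeighbors, G.loopless u]
  have hsum : t * M.card ≤ ∑ w ∈ M, G.indegree w := by
    calc t * M.card = ∑ _w ∈ M, t := by rw [Finset.sum_const, smul_eq_mul, mul_comm]
      _ ≤ ∑ w ∈ M, G.indegree w := Finset.sum_le_sum fun w hw =>
        (hx.threshold_le w (Finset.mem_filter.1 hw).2).trans (hx.le_indegree w)
  calc G.indegree u + t * (G.indegree u - (survivors G x u).card)
      = G.indegree u + t * M.card := by rw [← hcard, Nat.add_sub_cancel_left]
    _ ≤ G.indegree u + ∑ w ∈ M, G.indegree w := by omega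
    _ = ∑ w ∈ insert u M, G.indegree w := (Finset.sum_insert hu).symm
    _ ≤ ∑ w, G.indegree w := Finset.sum_le_sum_of_subset (Finset.subset_univ _)
    _ ≤ n * k := sum_indegree_le hG

end IsDeletionLevels

theorem mem_selected_of_edgesNotFrom_eq {G H : NominationGraph n} {T t k : ℕ} (ht : 1 ≤ t)
    (htT : t ≤ T) (hT : n * k < t * (T - t)) (hG : G ∈ withOutdegreeLE n k) {v : Fin n}
    (hGH : G.edgesNotFrom v = H.edgesNotFrom v) (hv : v ∈ selected T t G) :
    v ∈ selected T t H := by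
  obtain ⟨x, hx, hxdeg⟩ := exists_isDeletionLevels G ht
  obtain ⟨y, hy, hydeg⟩ := exists_isDeletionLevels H ht
  have hxv : T ≤ x v := by
    refine hx.le_of_le_card_survivors htT ?_
    rw [← hxdeg]
    unfold selected at hv
    split_ifs at hv with h
    · rw [(Finset.mem_filter.1 hv).2.1]
      exact h
    · simp at hv
  have heq : deletedFrom x t = deletedFrom y t := by
    by_contra hne
    have h1 := (hx.le_card_deletedFrom hy hGH hxv le_rfl htT hne).1
    have h2 := hx.mul_card_deletedFrom_le hG
    have h3 : t * (T - t) ≤ t * (deletedFrom x t).card := Nat.mul_le_mul_left t (by omega)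
    omega
  have hdeg : finalDegree G t = finalDegree H t := by
    funext u
    rw [hxdeg, hydeg, hx.survivors_eq hy hGH ht heq (htT.trans hxv)]
  have hsel : selected T t G = selected T t H := by
    unfold selected maxFinalDegree
    rw [hdeg]
  exact hsel ▸ hv

/-- If a vertex is selected, the shortfall is at most the loss `D - f`. Otherwise it is `D ≤ (T - 1)
+ (D - f)`; multiplying by `t` and using `D + t * (D - f) ≤ n * k` gives the bound. -/
theorem shortfall_mul_le {G : NominationGraph n} {T t k : ℕ} (ht : 1 ≤ t)
    (hT : t * (T - 1) ≤ t * t + n * k) (hG : G ∈ withOutdegreeLE n k) :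
    (G.maxIndegree - ∑ v ∈ selected T t G, G.indegree v) * (t + 1) ≤ t * t + 2 * (n * k) := by
  rcases isEmpty_or_nonempty (Fin n) with hn | hn
  · simp [maxIndegree]
  obtain ⟨x, hx, hxdeg⟩ := exists_isDeletionLevels G ht
  obtain ⟨u, -, hu⟩ := Finset.exists_mem_eq_sup Finset.univ Finset.univ_nonempty G.indegree
  have hu' : G.maxIndegree = G.indegree u := hu
  have hbound := hx.indegree_add_mul_le hG u
  have hsurv : (survivors G x u).card ≤ maxFinalDegree G t := by
    rw [← hxdeg]
    exact Finset.le_sup (f := finalDegree G t) (Finset.mem_univ u)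
  rw [hu']
  set D := G.indegree u
  set f := (survivors G x u).card
  by_cases hsel : T ≤ maxFinalDegree G t
  · set S := Finset.univ.filter fun v => finalDegree G t v = maxFinalDegree G t with hS
    have hSne : S.Nonempty := by
      obtain ⟨w, -, hw⟩ :=
        Finset.exists_mem_eq_sup Finset.univ Finset.univ_nonempty (finalDegree G t)
      exact ⟨w, Finset.mem_filter.2 ⟨Finset.mem_univ w, hw.symm⟩⟩
    obtain ⟨w, hwS, hmax⟩ := Finset.exists_max_image S id hSne
    have hwdeg : finalDegree G t w = maxFinalDegree G t := (Finset.mem_filter.1 hwS).2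
    have hw : w ∈ selected T t G := by
      rw [selected, if_pos hsel]
      refine Finset.mem_filter.2 ⟨Finset.mem_univ w, hwdeg, fun z hz => ?_⟩
      exact hmax z (Finset.mem_filter.2 ⟨Finset.mem_univ z, hz⟩)
    have h1 : G.indegree w ≤ ∑ v ∈ selected T t G, G.indegree v :=
      Finset.single_le_sum (f := G.indegree) (fun _ _ => Nat.zero_le _) hw
    have h2 : maxFinalDegree G t ≤ G.indegree w := by
      rw [← hwdeg, hxdeg]
      exact Finset.card_filter_le _ _
    have h3 : D - ∑ v ∈ selected T t G, G.indegree v ≤ D - f := by omega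
    have h4 : (D - f) * (t + 1) ≤ n * k := by
      have : (D - f) * (t + 1) = (D - f) + t * (D - f) := by ring
      omega
    have h5 := Nat.mul_le_mul_right (t + 1) h3
    omega
  · rw [selected, if_neg hsel, Finset.sum_empty, Nat.sub_zero]
    have h1 : D ≤ (T - 1) + (D - f) := by omega
    have h2 := Nat.mul_le_mul_left t h1
    have h3 : D * (t + 1) = t * D + D := by ring
    rw [Nat.mul_add] at h2
    omega

end TwinThreshold

theorem twinThresholdMechanism_impartialOn {n T t k : ℕ} (ht : 1 ≤ t) (htT : t ≤ T)
    (hT : n * k < t * (T - t)) :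
    (twinThresholdMechanism n T t).ImpartialOn (NominationGraph.withOutdegreeLE n k) := by
  intro G hG H hH v hGH
  ext w
  simp only [Finset.mem_inter, Finset.mem_singleton]
  refine and_congr_left ?_
  rintro rfl
  exact ⟨TwinThreshold.mem_selected_of_edgesNotFrom_eq ht htT hT hG hGH,
    TwinThreshold.mem_selected_of_edgesNotFrom_eq ht htT hT hH hGH.symm⟩

theorem twinThresholdMechanism_additiveOn {n T t k : ℕ} {α : ℝ} (ht : 1 ≤ t)
    (hT : t * (T - 1) ≤ t * t + n * k)
    (hα : (t : ℝ) ^ 2 + 2 * (n * k) ≤ α * (t + 1)) :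
    (twinThresholdMechanism n T t).AdditiveOn α (NominationGraph.withOutdegreeLE n k) := by
  intro G hG
  have h := TwinThreshold.shortfall_mul_le ht hT hG
  change (G.maxIndegree : ℝ) - ((∑ v ∈ TwinThreshold.selected T t G, G.indegree v : ℕ) : ℝ) ≤ α
  set s := ∑ v ∈ TwinThreshold.selected T t G, G.indegree v
  have h1 : (G.maxIndegree : ℝ) - (s : ℝ) ≤ ((G.maxIndegree - s : ℕ) : ℝ) := by
    rw [sub_le_iff_le_add]
    exact_mod_cast (by omega : G.maxIndegree ≤ G.maxIndegree - s + s)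
  have h2 : ((G.maxIndegree - s : ℕ) : ℝ) * ((t : ℝ) + 1) ≤ (t : ℝ) * t + 2 * (n * k) := by
    exact_mod_cast h
  have h3 : ((G.maxIndegree - s : ℕ) : ℝ) ≤ α :=
    le_of_mul_le_mul_right (by linarith [sq (t : ℝ)] : _ ≤ α * ((t : ℝ) + 1)) (by positivity)
  exact h1.trans h3

/-! ### Choice of thresholds -/

/-- For every lower threshold `t` there is an upper threshold that makes the mechanism impartial
without losing much in the additive guarantee. -/
theorem exists_upper_threshold {n t k : ℕ} {α : ℝ} (ht : 1 ≤ t)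
    (hα : (t : ℝ) ^ 2 + 2 * (n * k) ≤ α * (t + 1)) :
    ∃ T, t ≤ T ∧
      (twinThresholdMechanism n T t).ImpartialOn (NominationGraph.withOutdegreeLE n k) ∧
      (twinThresholdMechanism n T t).AdditiveOn α (NominationGraph.withOutdegreeLE n k) := by
  have htT : t ≤ t + n * k / t + 1 := Nat.le_succ_of_le (Nat.le_add_right _ _)
  -- The least `T` with `n * k < t * (T - t)`.
  refine ⟨t + n * k / t + 1, htT, twinThresholdMechanism_impartialOn ht htT ?_,
    twinThresholdMechanism_additiveOn ht ?_ hα⟩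
  · rw [Nat.add_assoc, Nat.add_sub_cancel_left]
    exact Nat.lt_mul_div_succ _ ht
  · rw [Nat.add_sub_cancel, Nat.mul_add]
    exact Nat.add_le_add_left (Nat.mul_div_le _ _) _

theorem twinThresholdMechanism_zero_additiveOn {T t k : ℕ} {α : ℝ} (hα : 0 ≤ α) :
    (twinThresholdMechanism 0 T t).AdditiveOn α (NominationGraph.withOutdegreeLE 0 k) := by
  intro G _
  have h : (0 : ℝ) ≤ ((∑ v ∈ (twinThresholdMechanism 0 T t).select G, G.indegree v : ℕ) : ℝ) :=
    Nat.cast_nonneg _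
  have h0 : G.maxIndegree = 0 := by simp [NominationGraph.maxIndegree]
  rw [h0, Nat.cast_zero]
  linarith

theorem twinThresholdMechanism_zero_impartialOn {T t k : ℕ} :
    (twinThresholdMechanism 0 T t).ImpartialOn (NominationGraph.withOutdegreeLE 0 k) :=
  fun _ _ _ _ v => v.elim0

theorem theorem1 :
    (∀ c : ℝ, 0 < c → ∃ C : ℝ, 0 < C ∧
      ∀ κ ∈ Set.Icc (0 : ℝ) 1, ∀ n k : ℕ, (k : ℝ) ≤ c * (n : ℝ) ^ κ →
        ∃ T t : ℕ, 1 ≤ t ∧ t ≤ T ∧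
          (twinThresholdMechanism n T t).ImpartialOn (NominationGraph.withOutdegreeLE n k) ∧
          (twinThresholdMechanism n T t).AdditiveOn (C * (n : ℝ) ^ ((1 + κ) / 2))
            (NominationGraph.withOutdegreeLE n k)) ∧
    (∀ n : ℕ, ∃ T t : ℕ, 1 ≤ t ∧ t ≤ T ∧
      (twinThresholdMechanism n T t).ImpartialOn (NominationGraph.withOutdegreeLE n 1) ∧
      (twinThresholdMechanism n T t).AdditiveOn (Real.sqrt (8 * (n : ℝ)))
        (NominationGraph.withOutdegreeLE n 1)) := by
  constructor
  · intro c hc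
    refine ⟨3 * (Real.sqrt c + 1), by positivity, fun κ hκ n k hk => ?_⟩
    -- For `n = 0` the target is 0, which the hypothesis of `exists_upper_threshold` excludes.
    rcases Nat.eq_zero_or_pos n with rfl | hn
    · exact ⟨1, 1, le_rfl, le_rfl, twinThresholdMechanism_zero_impartialOn,
        twinThresholdMechanism_zero_additiveOn (by positivity)⟩
    set p := (n : ℝ) ^ ((1 + κ) / 2) with hp
    have hn' : (0 : ℝ) < n := by exact_mod_cast hn
    have hp1 : 1 ≤ p := Real.one_le_rpow (by exact_mod_cast hn) (by linarith [hκ.1])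
    have hpsq : p ^ 2 = n * (n : ℝ) ^ κ := by
      rw [hp, ← Real.rpow_natCast, ← Real.rpow_mul hn'.le, ← Real.rpow_one_add' hn'.le
        (by linarith [hκ.1])]
      congr 1
      push_cast
      ring
    have hnk : ((n * k : ℕ) : ℝ) ≤ (Real.sqrt c * p) ^ 2 := by
      rw [mul_pow, Real.sq_sqrt hc.le, hpsq]
      push_cast
      nlinarith [mul_le_mul_of_nonneg_left hk hn'.le]
    set r := Nat.sqrt (n * k) with hr
    have hr1 : (r : ℝ) ≤ Real.sqrt c * p := by
      refine Real.nat_sqrt_le_real_sqrt.trans ?_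
      rw [Real.sqrt_le_left (by positivity)]
      exact hnk
    have hr2 : (n : ℝ) * k ≤ ((r : ℝ) + 1) ^ 2 := by
      exact_mod_cast (Nat.lt_succ_sqrt' (n * k)).le
    -- For `t = r + 1`, `t ^ 2 + 2 * (n * k) ≤ 3 * t ^ 2` and `t ≤ (√c + 1) * p`; hence the factor
    -- 3.
    obtain ⟨T, hT⟩ := exists_upper_threshold (n := n) (t := r + 1) (k := k)
      (α := 3 * (Real.sqrt c + 1) * p) (by omega) (by
        push_cast
        have h1 : (r : ℝ) + 1 ≤ (Real.sqrt c + 1) * p := by linarith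
        have h2 : (0 : ℝ) ≤ r := Nat.cast_nonneg r
        nlinarith)
    exact ⟨T, r + 1, by omega, hT⟩
  · intro n
    rcases Nat.eq_zero_or_pos n with rfl | hn
    · exact ⟨1, 1, le_rfl, le_rfl, twinThresholdMechanism_zero_impartialOn,
        twinThresholdMechanism_zero_additiveOn (by positivity)⟩
    have hn' : (1 : ℝ) ≤ n := by exact_mod_cast hn
    set r := Real.sqrt (2 * (n : ℝ)) with hr
    have hrsq : r ^ 2 = 2 * n := Real.sq_sqrt (by positivity)
    have hr1 : 1 ≤ r := Real.one_le_sqrt.2 (by linarith)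
    have h8 : Real.sqrt (8 * (n : ℝ)) = 2 * r := by
      rw [show 8 * (n : ℝ) = (2 * r) ^ 2 by rw [mul_pow, hrsq]; ring]
      exact Real.sqrt_sq (by positivity)
    have ht : 1 ≤ ⌊r⌋₊ := Nat.one_le_floor_iff _ |>.2 hr1
    obtain ⟨T, hT⟩ := exists_upper_threshold (n := n) (t := ⌊r⌋₊) (k := 1)
      (α := Real.sqrt (8 * (n : ℝ))) ht (by
        have h1 : (⌊r⌋₊ : ℝ) ≤ r := Nat.floor_le (by positivity)
        have h2 : r < ⌊r⌋₊ + 1 := Nat.lt_floor_add_one r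
        rw [h8, Nat.cast_one, mul_one, ← hrsq]
        -- With `t = ⌊r⌋₊`, the claim `t ^ 2 + r ^ 2 ≤ 2 * r * (t + 1)` is `(r - t) ^ 2 ≤ 2 * r`,
        -- true as `0 ≤ r - t < 1 ≤ r`.
        nlinarith)
    exact ⟨T, ⌊r⌋₊, ht, hT⟩
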